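/- Trees are full binary trees $t:\{0,1\}^*\to\Sigma$ over a finite alphabet $\Sigma$. An alternating automaton has a finite set of states $Q$ split into existential (Eve's) and universal (Adam's) states, an initial state $q_0$, a transition relation $\delta\subseteq Q\times\Sigma\times\{0,1,\varepsilon\}\times Q$ (we write $p\xrightarrow{\sigma,d}q$ for $(p,\sigma,d,q)\in\delta$), and a rank function $Q\to\mathbb N$; its index is (least rank, greatest rank). On a tree $t$, Eve and Adam move from $(q_0,\varepsilon)$ along moves $(p,v)\to(q,vd)$ with $p\xrightarrow{t(v),d}q$; the owner of $p$ chooses the move, and a player who cannot move loses. The automaton accepts $t$ if Eve has a winning strategy, where she wins an infinite play iff the highest rank occurring infinitely often is even; for a weak automaton she wins an infinite play iff the highest rank occurring at least once is even. An automaton is deterministic if all its states are universal, there are no $\varepsilon$-moves, and $\delta$ is a function $Q\times\Sigma\times\{0,1\}\to Q$. Two automata are equivalent if they accept the same trees. A loop is a path $p\xrightarrow{\sigma,d}p_0\to\dots\to p$ with at least one transition; it is accepting if the highest rank on it is even. A $(0,1)$-flower is a pair of loops $\lambda_0,\lambda_1$ starting in the same state such that the highest rank on $\lambda_0$ is even,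 and the highest rank on $\lambda_1$ is odd and larger than that on $\lambda_0$. A loop $p\xrightarrow{\sigma,d_0}p_0\to\dots\to p$ replicates a state $q$ if there is a path $p\xrightarrow{\sigma,d_1}p_1\to\dots\to q$ with $d_1\ne d_0$; it replicates a flower if it replicates some state on one of the loops of the flower. **Proposition.** There is an absolute constant $C$ such that every deterministic automaton with $n$ states that contains no $(0,1)$-flower replicated by an accepting loop is equivalent to a weak alternating automaton of index $(1,4)$ with at most $C n^2$ states. -/

import Mathlib

/-- A game position graph: `eve` is the set of positions owned by Eve, all other positions are
owned by Adam. -/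
structure RankedGame (V : Type*) where
  eve : Set V
  move : V → V → Prop
  start : V
  rank : V → ℕ

namespace RankedGame

variable {V : Type*} (G : RankedGame V)

/-- Finite partial plays consistent with a strategy `s` of Eve. Histories are written with the
most recent position first; a strategy chooses the next position from the whole history. -/
inductive Consistent (s : List V → V) : List V → Prop
  | init : Consistent s [G.start]
  | step {v w : V} {h : List V} : Consistent s (v :: h) → G.move v w →
      (v ∈ G.eve → w = s (v :: h)) → Consistent s (w :: v :: h)

/-- The history of the first `n + 1` positions of an infinite sequence, most recent first. -/
def hist (π : ℕ → V) : ℕ → List V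
  | 0 => [π 0]
  | n + 1 => π (n + 1) :: hist π n

/-- The highest rank visited infinitely often is even. -/
def ParityWin (π : ℕ → V) : Prop :=
  ∃ m, IsGreatest {k | ∃ᶠ i in Filter.atTop, G.rank (π i) = k} m ∧ Even m

/-- The highest rank visited at least once is even. -/
def WeakWin (π : ℕ → V) : Prop :=
  ∃ m, IsGreatest (Set.range fun i => G.rank (π i)) m ∧ Even m

/-- Eve has a winning strategy for the winning condition `W` on infinite plays. A player who
cannot move loses: the strategy always has to give Eve a legal move, and finite plays that end
because Adam cannot move are won by Eve. -/
def EveWins (W : (ℕ → V) → Prop) : Prop :=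
  ∃ s : List V → V,
    (∀ v h, G.Consistent s (v :: h) → v ∈ G.eve → G.move v (s (v :: h))) ∧
    (∀ π : ℕ → V, (∀ n, G.Consistent s (hist π n)) → W π)

end RankedGame

/-- Alternating automata on full binary trees over the alphabet `α` with state set `Q`.
A direction is `some false` (left), `some true` (right) or `none` (an `ε`-move). States outside
`existential` are universal. -/
structure AltAutomaton (α Q : Type*) where
  existential : Set Q
  init : Q
  trans : Q → α → Option Bool → Q → Prop
  rank : Q → ℕ

namespace AltAutomaton

variable {α Q : Type*} (A : AltAutomaton α Q)

/-- The acceptance game of `A` on the tree `t`: positions are pairs of a state and a node. -/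
def game (t : List Bool → α) : RankedGame (Q × List Bool) where
  eve := {x | x.1 ∈ A.existential}
  move x y := ∃ d : Option Bool, A.trans x.1 (t x.2) d y.1 ∧ y.2 = x.2 ++ d.toList
  start := (A.init, [])
  rank x := A.rank x.1

/-- The language recognized with the parity acceptance condition. -/
def language : Set (List Bool → α) :=
  {t | (A.game t).EveWins (A.game t).ParityWin}

/-- The language recognized by `A` viewed as a weak automaton. -/
def weakLanguage : Set (List Bool → α) :=
  {t | (A.game t).EveWins (A.game t).WeakWin}

/-- Eve has no choice, there are no `ε`-moves, and the transition relation is a function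
`Q × α × {0,1} → Q`. -/
def IsDeterministic : Prop :=
  A.existential = ∅ ∧ (∀ p a q, ¬ A.trans p a none q) ∧
    ∀ p a (d : Bool), ∃! q, A.trans p a (some d) q

/-- The index of `A` is `(ι, κ)`: these are the least and the greatest rank of its states. -/
def HasIndex (ι κ : ℕ) : Prop :=
  IsLeast (Set.range A.rank) ι ∧ IsGreatest (Set.range A.rank) κ

/-- `A.IsPath p l q`: `l` lists the successive transitions (letter, direction, target state) of a
path from `p` to `q`. -/
def IsPath : Q → List (α × Option Bool × Q) → Q → Prop
  | p, [], q => p = q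
  | p, (a, d, r) :: l, q => A.trans p a d r ∧ IsPath r l q

/-- A loop starting in `p`: a path from `p` to `p` with at least one transition. As it ends in
`p`, its states are exactly the targets of its transitions. -/
def IsLoop (p : Q) (l : List (α × Option Bool × Q)) : Prop :=
  l ≠ [] ∧ A.IsPath p l p

/-- The highest rank among the targets of the transitions in `l`. -/
def highestRank (l : List (α × Option Bool × Q)) : ℕ :=
  (l.map fun e => A.rank e.2.2).foldr max 0

/-- A loop is accepting if the highest rank on it is even. -/
def IsAcceptingLoop (p : Q) (l : List (α × Option Bool × Q)) : Prop :=
  A.IsLoop p l ∧ Even (A.highestRank l)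

/-- The state `q` is replicated by the loop `l` starting in `p` with a transition over the letter
`a` in direction `d₀`: some path from `p` to `q` starts with a transition over the same letter in a
different direction. -/
def Replicates (p : Q) : List (α × Option Bool × Q) → Q → Prop
  | [], _ => False
  | (a, d₀, _) :: _, q => ∃ d₁ p₁ l', d₁ ≠ d₀ ∧ A.trans p a d₁ p₁ ∧ A.IsPath p₁ l' q

/-- The loops `lam ι, …, lam κ`, all starting in `p`, form an `(ι, κ)`-flower. -/
def IsFlower (ι κ : ℕ) (p : Q) (lam : ℕ → List (α × Option Bool × Q)) : Prop :=
  (∀ i ∈ Set.Icc ι κ, A.IsLoop p (lam i) ∧ (Even (A.highestRank (lam i)) ↔ Even i)) ∧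
    ∀ i ∈ Set.Ico ι κ, A.highestRank (lam i) < A.highestRank (lam (i + 1))

/-- `A` contains an `(ι, κ)`-flower that is replicated by an accepting loop, that is, one with a
state on one of its loops that is replicated by an accepting loop. -/
def HasReplicatedFlower (ι κ : ℕ) : Prop :=
  ∃ p lam, A.IsFlower ι κ p lam ∧ ∃ p' l, A.IsAcceptingLoop p' l ∧
    ∃ i ∈ Set.Icc ι κ, ∃ e ∈ lam i, A.Replicates p' l e.2.2

end AltAutomaton

/-! Let R be the set of states replicated by an accepting loop (`replicated`); runs never leave R.
Suppose the run accepts on every branch. On a branch avoiding R, late segments that return to their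
first state through the highest recurrent rank are accepting loops, so all siblings hanging off the
branch from some node on lie in R. Thus every branch has a node below which each branch enters R or
is one fixed branch, controlled by guessing its highest recurrent rank (`exists_good`).

Inside R, parity collapses to a Büchi condition: infinitely many visits to states of even rank that
are the peak of some loop (`evenPeaks`). If the highest recurrent rank were odd, a loop of the run
through that rank and the loop of a recurrent peak would form a replicated (0,1)-flower
(`parityAccepts_of_goal`).

So acceptance says that every branch has a node from which all branches satisfy a safety and a Büchi
condition. All branches meet goals infinitely often iff from every node every branch meets a goal,
which a weak automaton can check: Eve has to stop waiting (rank 1), Adam descends (2) and may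
challenge (3), and reaching a goal answers him (4). -/

namespace RankedGame

/-! ### Strategies and plays -/

variable {V : Type*} {G : RankedGame V} {W : (ℕ → V) → Prop}

lemma hist_eq_cons (π : ℕ → V) (n : ℕ) : ∃ h, hist π n = π n :: h := by
  cases n <;> exact ⟨_, rfl⟩

lemma consistent_singleton {s : List V → V} {v : V} (h : G.Consistent s [v]) : v = G.start := by
  generalize hl : [v] = l at h
  cases h <;> simp_all

lemma consistent_cons_cons {s : List V → V} {v w : V} {h : List V}
    (hc : G.Consistent s (w :: v :: h)) :
    G.move v w ∧ (v ∈ G.eve → w = s (v :: h)) := by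
  generalize hl : w :: v :: h = l at hc
  cases hc with
  | init => simp at hl
  | step _ hm hs =>
    simp only [List.cons.injEq] at hl
    obtain ⟨rfl, rfl, rfl⟩ := hl
    exact ⟨hm, hs⟩

/-- If Eve wins, then against every way in which Adam can play there is a winning play. Adam's way
to play is given by a set `P` of positions that he never lets the play leave, and a relation `M`
that holds for all moves made. -/
lemma EveWins.exists_play (hW : G.EveWins W) (P : V → Prop) (M : V → V → Prop) (h0 : P G.start)
    (hE : ∀ v, P v → v ∈ G.eve → ∀ w, G.move v w → P w ∧ M v w)
    (hA : ∀ v, P v → v ∉ G.eve → ∃ w, G.move v w ∧ P w ∧ M v w) :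
    ∃ π : ℕ → V, W π ∧ π 0 = G.start ∧
      ∀ n, P (π n) ∧ G.move (π n) (π (n + 1)) ∧ M (π n) (π (n + 1)) := by
  classical
  obtain ⟨s, hs, hwin⟩ := hW
  have key : ∀ v h, G.Consistent s (v :: h) → P v →
      ∃ w, G.Consistent s (w :: v :: h) ∧ P w ∧ G.move v w ∧ M v w := by
    intro v h hc hp
    by_cases hv : v ∈ G.eve
    · have hm := hs v h hc hv
      exact ⟨_, .step hc hm fun _ => rfl, (hE v hp hv _ hm).1, hm, (hE v hp hv _ hm).2⟩
    · obtain ⟨w, hm, hpw, hM⟩ := hA v hp hv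
      exact ⟨w, .step hc hm fun h => absurd h hv, hpw, hm, hM⟩
  -- The strategy reads whole histories, so the recursion carries histories rather than positions.
  let S := {x : V × List V // G.Consistent s (x.1 :: x.2) ∧ P x.1}
  choose f hf using fun x : S => key x.1.1 x.1.2 x.2.1 x.2.2
  let H : ℕ → S := fun n => Nat.rec ⟨(G.start, []), .init, h0⟩
    (fun _ x => ⟨(f x, x.1.1 :: x.1.2), (hf x).1, (hf x).2.1⟩) n
  let π : ℕ → V := fun n => (H n).1.1
  have hh : ∀ n, hist π n = (H n).1.1 :: (H n).1.2 := by
    intro n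
    induction n with
    | zero => rfl
    | succ n ih => rw [hist, ih]
  exact ⟨π, hwin π fun n => hh n ▸ (H n).2.1, rfl, fun n => ⟨(H n).2.2, (hf (H n)).2.2⟩⟩

/-- A positional strategy `f` with invariant `I` that wins all infinite plays it allows. -/
lemma EveWins.of_positional (f : V → V) (I : V → Prop) (h0 : I G.start)
    (hf : ∀ v, I v → v ∈ G.eve → G.move v (f v))
    (hI : ∀ v w, I v → G.move v w → (v ∈ G.eve → w = f v) → I w)
    (hW : ∀ π : ℕ → V, π 0 = G.start → (∀ n, I (π n)) → (∀ n, G.move (π n) (π (n + 1))) →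
      (∀ n, π n ∈ G.eve → π (n + 1) = f (π n)) → W π) : G.EveWins W := by
  let s : List V → V := fun h => f (h.headD G.start)
  have inv : ∀ h, G.Consistent s h → I (h.headD G.start) := by
    intro h hc
    induction hc with
    | init => exact h0
    | step hc hm hs ih => exact hI _ _ ih hm hs
  refine ⟨s, fun v h hc hv => hf v (inv _ hc) hv, fun π hπ => ?_⟩
  have hstep : ∀ n, G.move (π n) (π (n + 1)) ∧ (π n ∈ G.eve → π (n + 1) = f (π n)) := by
    intro n
    have hc := hπ (n + 1)
    obtain ⟨h, hh⟩ := hist_eq_cons π n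
    rw [hist, hh] at hc
    exact consistent_cons_cons hc
  refine hW π ?_ (fun n => ?_) (fun n => (hstep n).1) fun n => (hstep n).2
  · exact consistent_singleton (hπ 0)
  · obtain ⟨h, hh⟩ := hist_eq_cons π n
    have := inv _ (hπ n)
    rwa [hh] at this

end RankedGame

/-! ### Branches of the binary tree -/

/-- The node at depth `n` of the branch `β`. -/
def branchNode (β : ℕ → Bool) (n : ℕ) : List Bool := (List.range n).map β

lemma branchNode_succ (β : ℕ → Bool) (n : ℕ) :
    branchNode β (n + 1) = branchNode β n ++ [β n] := by
  simp [branchNode, List.range_succ]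

@[simp] lemma length_branchNode (β : ℕ → Bool) (n : ℕ) : (branchNode β n).length = n := by
  simp [branchNode]

/-- Every sequence of nodes in which each one is extended by the next lies on a branch. -/
lemma exists_branch (v : ℕ → List Bool) (hv : ∀ n, v n <+: v (n + 1)) :
    ∃ β, ∀ n, v n = branchNode β (v n).length := by
  classical
  have mono : ∀ m n, m ≤ n → v m <+: v n := by
    intro m n h
    induction h with
    | refl => exact List.prefix_rfl
    | step _ ih => exact ih.trans (hv _)
  -- By `mono`, any node longer than `k` gives the same `k`-th direction. The lengths may stay
  -- bounded because of ε-moves; then the rest of the branch is arbitrary.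
  refine ⟨fun k => if h : ∃ N, k < (v N).length then (v h.choose)[k]'h.choose_spec else false,
    fun n => ?_⟩
  apply List.ext_getElem
  · simp
  · intro k h1 h2
    have hk : ∃ N, k < (v N).length := ⟨n, h1⟩
    simp only [branchNode, List.getElem_map, List.getElem_range, hk, dite_true]
    rcases le_total n hk.choose with h | h
    · exact (mono _ _ h).getElem h1
    · exact ((mono _ _ h).getElem hk.choose_spec).symm

/-! ### Ranks seen infinitely often -/

open Filter

/-- The parity condition for a sequence of states. -/
def ParityAccepts {Q : Type*} (rank : Q → ℕ) (x : ℕ → Q) : Prop :=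
  ∃ m, IsGreatest {k | ∃ᶠ i in atTop, rank (x i) = k} m ∧ Even m

section Sequences

variable {Q : Type*} [Finite Q] (rank : Q → ℕ) (x : ℕ → Q)

/-- There are finitely many states, and each one not visited infinitely often has a last visit.
Beyond `N` every state comes back, so loops can be cut out of the run. -/
lemma exists_recurrent : ∃ N, ∀ i ≥ N, ∃ᶠ j in atTop, x j = x i := by
  have : ∀ q, ∀ᶠ i in atTop, x i = q → ∃ᶠ j in atTop, x j = q := by
    intro q
    by_cases hq : ∃ᶠ j in atTop, x j = q
    · exact Eventually.of_forall fun _ _ => hq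
    · exact (not_frequently.1 hq).mono fun i hi h => absurd h hi
  obtain ⟨N, hN⟩ := eventually_atTop.1 (eventually_all.2 this)
  exact ⟨N, fun i hi => hN i hi _ rfl⟩

lemma exists_isGreatest_frequently :
    ∃ m, IsGreatest {k | ∃ᶠ i in atTop, rank (x i) = k} m := by
  have hfin : {k | ∃ᶠ i in atTop, rank (x i) = k}.Finite := by
    refine (Set.finite_range rank).subset fun k hk => ?_
    obtain ⟨i, hi⟩ := hk.exists
    exact ⟨_, hi⟩
  obtain ⟨N, hN⟩ := exists_recurrent x
  have hne : {k | ∃ᶠ i in atTop, rank (x i) = k}.Nonempty :=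
    ⟨rank (x N), (hN N le_rfl).mono fun i hi => by rw [hi]⟩
  obtain ⟨m, hm, hmax⟩ := Set.exists_max_image _ id hfin hne
  exact ⟨m, hm, fun k hk => hmax k hk⟩

end Sequences

namespace AltAutomaton

variable {α Q : Type*} {A : AltAutomaton α Q}

/-! ### Paths -/

lemma IsPath.append {p q r : Q} {l l' : List (α × Option Bool × Q)} (h : A.IsPath p l q)
    (h' : A.IsPath q l' r) : A.IsPath p (l ++ l') r := by
  induction l generalizing p with
  | nil => cases h; exact h'
  | cons e l ih => exact ⟨h.1, ih h.2⟩

lemma IsPath.exists_mem_target {p q : Q} {l : List (α × Option Bool × Q)} (h : A.IsPath p l q)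
    (hl : l ≠ []) : ∃ e ∈ l, e.2.2 = q := by
  induction l generalizing p with
  | nil => exact absurd rfl hl
  | cons e l ih =>
    by_cases hl' : l = []
    · subst hl'
      exact ⟨e, by simp, h.2⟩
    · obtain ⟨e', he', h'⟩ := ih h.2 hl'
      exact ⟨e', List.mem_cons_of_mem _ he', h'⟩

lemma highestRank_cons (e : α × Option Bool × Q) (l : List (α × Option Bool × Q)) :
    A.highestRank (e :: l) = max (A.rank e.2.2) (A.highestRank l) := rfl

lemma highestRank_le_iff {l : List (α × Option Bool × Q)} {m : ℕ} :
    A.highestRank l ≤ m ↔ ∀ e ∈ l, A.rank e.2.2 ≤ m := by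
  induction l with
  | nil => simp [highestRank]
  | cons e l ih => simp [highestRank_cons, ih]

/-- The states that are replicated by an accepting loop. -/
def replicated (A : AltAutomaton α Q) : Set Q :=
  {q | ∃ p l, A.IsAcceptingLoop p l ∧ A.Replicates p l q}

/-- The replicating path is prolonged by the transition. -/
lemma replicated_of_trans {p q : Q} {a : α} {d : Option Bool} (hp : p ∈ A.replicated)
    (h : A.trans p a d q) : q ∈ A.replicated := by
  obtain ⟨r, l, hl, hrep⟩ := hp
  refine ⟨r, l, hl, ?_⟩
  match l, hrep with
  | (b, d₀, _) :: _, ⟨d₁, p₁, l', hd, ht, hpath⟩ =>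
    exact ⟨d₁, p₁, l' ++ [(a, d, q)], hd, ht, hpath.append ⟨h, rfl⟩⟩

/-- The states of even rank that have the highest rank on some loop. -/
def evenPeaks (A : AltAutomaton α Q) : Set Q :=
  {q | Even (A.rank q) ∧ ∃ l, A.IsLoop q l ∧ A.highestRank l = A.rank q}

/-! ### Runs of deterministic automata -/

namespace IsDeterministic

/-- The transition function. -/
noncomputable def next (hA : A.IsDeterministic) (p : Q) (a : α) (d : Bool) : Q :=
  (hA.2.2 p a d).choose

lemma trans_iff (hA : A.IsDeterministic) {p : Q} {a : α} {d : Bool} {q : Q} :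
    A.trans p a (some d) q ↔ q = hA.next p a d :=
  ⟨fun h => (hA.2.2 p a d).choose_spec.2 q h, fun h => h ▸ (hA.2.2 p a d).choose_spec.1⟩

/-- The state of the run on `t` at a node that is given in reverse. -/
noncomputable def runRev (hA : A.IsDeterministic) (t : List Bool → α) : List Bool → Q
  | [] => A.init
  | d :: w => hA.next (runRev hA t w) (t w.reverse) d

/-- The state of the run on `t` at the node `v`. -/
noncomputable def run (hA : A.IsDeterministic) (t : List Bool → α) (v : List Bool) : Q :=
  hA.runRev t v.reverse

variable (hA : A.IsDeterministic) {t : List Bool → α}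

lemma run_append (v : List Bool) (d : Bool) :
    hA.run t (v ++ [d]) = hA.next (hA.run t v) (t v) d := by
  simp [run, runRev]

lemma trans_run_iff {v : List Bool} {d : Bool} {q : Q} :
    A.trans (hA.run t v) (t v) (some d) q ↔ q = hA.run t (v ++ [d]) := by
  rw [hA.trans_iff, run_append]

/-- The states of the run on `t` along a branch. -/
noncomputable def branchRun (t : List Bool → α) (β : ℕ → Bool) (n : ℕ) : Q :=
  hA.run t (branchNode β n)

lemma trans_branchRun (β : ℕ → Bool) (n : ℕ) : A.trans (hA.branchRun t β n)
    (t (branchNode β n)) (some (β n)) (hA.branchRun t β (n + 1)) := by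
  rw [branchRun, trans_run_iff, branchRun, branchNode_succ]

/-- Adam owns every position and there are no ε-moves, so plays correspond to branches. -/
lemma mem_language_iff :
    t ∈ A.language ↔ ∀ β, ParityAccepts A.rank (hA.branchRun t β) := by
  constructor
  · intro ht β
    obtain ⟨π, hπ, hπ0, h⟩ := RankedGame.EveWins.exists_play ht
      (fun y => y.1 = hA.run t y.2 ∧ y.2 = branchNode β y.2.length)
      (fun y z => z.2.length = y.2.length + 1) ⟨rfl, rfl⟩
      (fun v _ hv => by simp [game, hA.1] at hv) (by
        rintro ⟨q, v⟩ ⟨hq, hv⟩ -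
        dsimp only at hq hv
        subst hq
        refine ⟨(hA.run t (v ++ [β v.length]), v ++ [β v.length]),
          ⟨some _, hA.trans_run_iff.2 rfl, rfl⟩, ⟨rfl, ?_⟩, by simp⟩
        simp only [List.length_append, List.length_singleton]
        rw [branchNode_succ, ← hv])
    have hlen : ∀ n, (π n).2.length = n := by
      intro n
      induction n with
      | zero => rw [hπ0]; rfl
      | succ n ih => rw [(h n).2.2, ih]
    have : ∀ n, (A.game t).rank (π n) = A.rank (hA.branchRun t β n) := by
      intro n
      have h1 := (h n).1
      rw [hlen] at h1
      rw [branchRun, ← h1.2, ← h1.1]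
      rfl
    simpa only [RankedGame.ParityWin, this, ParityAccepts] using hπ
  · intro h
    refine RankedGame.EveWins.of_positional id (fun y => y.1 = hA.run t y.2) rfl
      (fun v _ hv => by simp [game, hA.1] at hv) ?_ ?_
    · rintro ⟨q, v⟩ ⟨q', v'⟩ hq ⟨d, hd, hv'⟩ -
      dsimp only at hq
      subst hq
      cases d with
      | none => exact absurd hd (hA.2.1 _ _ _)
      | some d =>
        obtain rfl : v' = v ++ [d] := hv'
        exact hA.trans_run_iff.1 hd
    · intro π hπ0 hI hm _
      obtain ⟨β, hβ⟩ := exists_branch (fun n => (π n).2) fun n => by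
        obtain ⟨d, -, hd⟩ := hm n
        exact ⟨_, hd.symm⟩
      have hlen : ∀ n, (π n).2.length = n := by
        intro n
        induction n with
        | zero => rw [hπ0]; rfl
        | succ n ih =>
          obtain ⟨d, hd, hv⟩ := hm n
          cases d with
          | none => exact absurd hd (hA.2.1 _ _ _)
          | some d => rw [hv]; simp [ih]
      have : ∀ n, (A.game t).rank (π n) = A.rank (hA.branchRun t β n) := by
        intro n
        have h1 := hβ n
        simp only [hlen] at h1
        rw [branchRun, ← h1, ← hI n]
        rfl
      simpa only [RankedGame.ParityWin, this, ParityAccepts] using h β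

lemma branchRun_mem_replicated {β : ℕ → Bool} {i j : ℕ} (hij : i ≤ j)
    (hi : hA.branchRun t β i ∈ A.replicated) : hA.branchRun t β j ∈ A.replicated := by
  induction hij with
  | refl => exact hi
  | step _ ih => exact replicated_of_trans ih (hA.trans_branchRun β _)

lemma exists_path_branchRun (t : List Bool → α) (β : ℕ → Bool) (i n : ℕ) :
    ∃ l, A.IsPath (hA.branchRun t β i) l (hA.branchRun t β (i + n)) ∧
      l.map (fun e => e.2.2) = (List.range' (i + 1) n).map (hA.branchRun t β) ∧
      ∀ e ∈ l.head?, e.1 = t (branchNode β i) ∧ e.2.1 = some (β i) := by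
  induction n generalizing i with
  | zero => exact ⟨[], rfl, rfl, by simp⟩
  | succ n ih =>
    obtain ⟨l, hl, hmap, -⟩ := ih (i + 1)
    refine ⟨(t (branchNode β i), some (β i), hA.branchRun t β (i + 1)) :: l,
      ⟨hA.trans_branchRun β i, ?_⟩, ?_, ?_⟩
    · rwa [show i + (n + 1) = i + 1 + n by omega]
    · rw [List.map_cons, hmap, List.range'_succ, List.map_cons]
    · simp

/-- A segment of the run along a branch between two visits to the same state is a loop. -/
lemma exists_loop_branchRun {β : ℕ → Bool} {i j k m : ℕ} (hij : i < j) (hjk : j ≤ k)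
    (hk : hA.branchRun t β k = hA.branchRun t β i) (hj : A.rank (hA.branchRun t β j) = m)
    (hm : ∀ n ≥ i, A.rank (hA.branchRun t β n) ≤ m) :
    ∃ q l, A.IsLoop (hA.branchRun t β i) ((t (branchNode β i), some (β i), q) :: l) ∧
      A.highestRank ((t (branchNode β i), some (β i), q) :: l) = m := by
  obtain ⟨n, rfl⟩ : ∃ n, k = i + n := ⟨k - i, by omega⟩
  obtain ⟨l, hl, hmap, hhead⟩ := hA.exists_path_branchRun t β i n
  rw [hk] at hl
  have hmem : ∀ q, (∃ e ∈ l, e.2.2 = q) ↔ ∃ r, (i + 1 ≤ r ∧ r < i + 1 + n) ∧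
      hA.branchRun t β r = q := by
    intro q
    have : q ∈ l.map (fun e => e.2.2) ↔ q ∈ (List.range' (i + 1) n).map (hA.branchRun t β) := by
      rw [hmap]
    simpa only [List.mem_map, List.mem_range'_1] using this
  have hrank : A.highestRank l = m := by
    apply le_antisymm
    · rw [highestRank_le_iff]
      intro e he
      obtain ⟨r, hr, hre⟩ := (hmem _).1 ⟨e, he, rfl⟩
      rw [← hre]
      exact hm r (by omega)
    · obtain ⟨e, he, hej⟩ := (hmem (hA.branchRun t β j)).2 ⟨j, by omega, rfl⟩
      rw [← hj, ← hej]
      exact highestRank_le_iff.1 le_rfl e he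
  match l, hl, hhead, hrank, hmap with
  | [], _, _, _, hmap =>
    have := congrArg List.length hmap
    simp at this
    omega
  | (a, d, q) :: l, hl, hhead, hrank, _ =>
    obtain ⟨rfl, rfl⟩ : a = t (branchNode β i) ∧ d = some (β i) := hhead (a, d, q) (by simp)
    exact ⟨q, l, ⟨by simp, hl⟩, hrank⟩

end IsDeterministic

/-! ### The conditions tracked by the weak automaton -/

/-- With `m` as the guess of the highest rank seen infinitely often, the state `q` may occur. -/
def Safe (A : AltAutomaton α Q) (q m : Q) : Prop :=
  q ∈ A.replicated ∨ A.rank q ≤ A.rank m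

/-- With `m` as the guess of the highest rank seen infinitely often, the state `q` is one of those
that have to occur infinitely often. -/
def Goal (A : AltAutomaton α Q) (q m : Q) : Prop :=
  (q ∈ A.replicated ∧ q ∈ A.evenPeaks) ∨
    (q ∉ A.replicated ∧ A.rank q = A.rank m ∧ Even (A.rank m))

namespace IsDeterministic

variable (hA : A.IsDeterministic) {t : List Bool → α}

/-- All branches through `v` satisfy the tracked conditions from `v` on. -/
def Good (t : List Bool → α) (v : List Bool) (m : Q) : Prop :=
  ∀ β, branchNode β v.length = v → (∀ n ≥ v.length, A.Safe (hA.branchRun t β n) m) ∧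
    ∃ᶠ n in atTop, A.Goal (hA.branchRun t β n) m

variable {hA}

lemma Good.append {v : List Bool} {m : Q} (h : hA.Good t v m) (d : Bool) :
    hA.Good t (v ++ [d]) m := by
  intro β hβ
  rw [List.length_append, List.length_singleton, branchNode_succ] at hβ
  have := h β (List.append_inj hβ (by simp)).1
  exact ⟨fun n hn => this.1 n (by simp at hn; omega), this.2⟩

lemma Good.safe {v : List Bool} {m : Q} (h : hA.Good t v m) : A.Safe (hA.run t v) m := by
  -- Some branch through `v` is needed; beyond `v` it always turns left.
  have hβ : branchNode (fun n => v.getD n false) v.length = v := by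
    apply List.ext_getElem <;> simp +contextual [branchNode]
  have := (h _ hβ).1 _ le_rfl
  rwa [branchRun, hβ] at this

/-! ### Tracked conditions versus the parity condition -/

variable (hA) [Finite Q]

/-- A late position of the highest recurrent rank has a recurrent state, and the run up to the next
visit to that state is a loop with this rank as its peak. -/
lemma frequently_evenPeaks {β : ℕ → Bool} (h : ParityAccepts A.rank (hA.branchRun t β)) :
    ∃ᶠ n in atTop, hA.branchRun t β n ∈ A.evenPeaks := by
  obtain ⟨m, hm, hev⟩ := h
  obtain ⟨N, hN⟩ := exists_recurrent (hA.branchRun t β)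
  refine (hm.1.and_eventually (eventually_ge_atTop N)).mono ?_
  rintro j ⟨hj, hjN⟩
  obtain ⟨k, hjk, hk⟩ := frequently_atTop.1 (hN j hjN) (j + 1)
  obtain ⟨q, l, hl, hr⟩ := hA.exists_loop_branchRun (m := m) (show j < k from hjk) le_rfl hk
    (by rw [hk, hj]) fun n hn => hm.2 ((hN n (by omega)).mono fun i hi => by rw [hi])
  exact ⟨hj ▸ hev, _, hl, by rw [hr, hj]⟩

/-- A branch that satisfies the tracked conditions from some point on is accepting. -/
lemma parityAccepts_of_goal (hfl : ¬ A.HasReplicatedFlower 0 1) {β : ℕ → Bool} {N : ℕ} {m : Q}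
    (hs : ∀ n ≥ N, A.Safe (hA.branchRun t β n) m)
    (hg : ∃ᶠ n in atTop, A.Goal (hA.branchRun t β n) m) :
    ParityAccepts A.rank (hA.branchRun t β) := by
  by_cases hR : ∃ n, hA.branchRun t β n ∈ A.replicated
  · obtain ⟨n₀, hn₀⟩ := hR
    obtain ⟨k, hk⟩ := exists_isGreatest_frequently A.rank (hA.branchRun t β)
    refine ⟨k, hk, by_contra fun hodd => hfl ?_⟩
    obtain ⟨N', hN'⟩ := exists_recurrent (hA.branchRun t β)
    obtain ⟨i, hi, hgi⟩ := frequently_atTop.1 hg (max n₀ N')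
    have hmem := hA.branchRun_mem_replicated (le_of_max_le_left hi) hn₀
    obtain ⟨hev, l₀, hl₀, hr₀⟩ : hA.branchRun t β i ∈ A.evenPeaks := by
      rcases hgi with h | h
      · exact h.2
      · exact absurd hmem h.1
    have hle : ∀ n ≥ i, A.rank (hA.branchRun t β n) ≤ k := fun n hn =>
      hk.2 ((hN' n (by omega)).mono fun i hi => by rw [hi])
    obtain ⟨j, hij, hj⟩ := frequently_atTop.1 hk.1 (i + 1)
    obtain ⟨r, hjr, hr⟩ := frequently_atTop.1 (hN' i (by omega)) j
    obtain ⟨q, l, hl, hr₁⟩ := hA.exists_loop_branchRun (show i < j from hij) hjr hr hj hle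
    obtain ⟨p', l', hl', hrep⟩ := hmem
    -- The replicated state of a flower must be the target of a transition on a petal; here it is
    -- the common base point, where `l₀` ends.
    obtain ⟨e, he, hei⟩ := hl₀.2.exists_mem_target hl₀.1
    refine ⟨hA.branchRun t β i,
      fun n => if n = 0 then l₀ else (t (branchNode β i), some (β i), q) :: l, ⟨?_, ?_⟩,
      p', l', hl', 0, by simp, e, by simpa using he, by rwa [hei]⟩
    · intro n hn
      obtain rfl | rfl : n = 0 ∨ n = 1 := by
        have := hn.2
        omega
      · simpa [hr₀] using ⟨hl₀, hev⟩
      · simpa [hr₁] using ⟨hl, by simpa using hodd⟩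
    · intro n hn
      obtain rfl : n = 0 := by
        have := hn.2
        omega
      -- The rank of the peak is at most `k` and differs from it in parity.
      have hlt : A.rank (hA.branchRun t β i) < k := by
        refine lt_of_le_of_ne (hle i le_rfl) fun h => hodd (h ▸ hev)
      simpa [hr₀, hr₁] using hlt
  · push Not at hR
    have hg' : ∃ᶠ n in atTop, A.rank (hA.branchRun t β n) = A.rank m ∧ Even (A.rank m) := by
      refine hg.mono fun n hn => ?_
      rcases hn with h | h
      · exact absurd h.1 (hR n)
      · exact h.2
    refine ⟨A.rank m, ⟨hg'.mono fun _ h => h.1, fun k hk => ?_⟩, hg'.exists.choose_spec.2⟩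
    obtain ⟨n, hn, rfl⟩ := frequently_atTop.1 hk N
    exact (hs n hn).resolve_left (hR n)

/-- If the run is accepting on all branches, then on each branch there is a node from which on the
tracked conditions hold. -/
lemma exists_good (h : ∀ β, ParityAccepts A.rank (hA.branchRun t β)) (β : ℕ → Bool) :
    ∃ n m, hA.Good t (branchNode β n) m := by
  have hgoal : ∀ β' n m, hA.branchRun t β' n ∈ A.replicated →
      ∃ᶠ k in atTop, A.Goal (hA.branchRun t β' k) m := by
    intro β' n m hn
    refine ((hA.frequently_evenPeaks (h β')).and_eventually (eventually_ge_atTop n)).mono ?_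
    rintro k ⟨hk, hnk⟩
    exact Or.inl ⟨hA.branchRun_mem_replicated hnk hn, hk⟩
  by_cases hR : ∃ n, hA.branchRun t β n ∈ A.replicated
  · obtain ⟨n, hn⟩ := hR
    -- Once the run is in R, the guess is irrelevant.
    refine ⟨n, A.init, fun β' hβ' => ?_⟩
    rw [length_branchNode] at hβ' ⊢
    have hn' : hA.branchRun t β' n ∈ A.replicated := by rwa [branchRun, hβ']
    exact ⟨fun k hk => Or.inl (hA.branchRun_mem_replicated hk hn'), hgoal β' n _ hn'⟩
  · push Not at hR
    obtain ⟨N, hN⟩ := exists_recurrent (hA.branchRun t β)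
    obtain ⟨k, hk, hev⟩ := h β
    have hle : ∀ n ≥ N, A.rank (hA.branchRun t β n) ≤ k := fun n hn =>
      hk.2 ((hN n hn).mono fun i hi => by rw [hi])
    obtain ⟨j₀, hj₀⟩ := hk.1.exists
    refine ⟨N, hA.branchRun t β j₀, fun β' hβ' => ?_⟩
    rw [length_branchNode] at hβ' ⊢
    -- From position `i` the branch runs through rank `k` and returns to the same state: an
    -- accepting loop, which leaves in direction `β i` and so replicates the sibling.
    have hsib : ∀ i ≥ N, ∀ d, d ≠ β i →
        hA.run t (branchNode β i ++ [d]) ∈ A.replicated := by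
      intro i hi d hd
      obtain ⟨j, hij, hj⟩ := frequently_atTop.1 hk.1 (i + 1)
      obtain ⟨r, hjr, hr⟩ := frequently_atTop.1 (hN i hi) j
      obtain ⟨q, l, hl, hrank⟩ := hA.exists_loop_branchRun (show i < j from hij) hjr hr hj
        fun n hn => hle n (by omega)
      exact ⟨_, _, ⟨hl, hrank ▸ hev⟩, some d, _, [], by simpa using hd,
        hA.trans_run_iff.2 rfl, rfl⟩
    have hdich : ∀ n ≥ N, branchNode β' n = branchNode β n ∨
        hA.branchRun t β' n ∈ A.replicated := by
      intro n hn
      induction n, hn using Nat.le_induction with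
      | base => exact Or.inl hβ'
      | succ n hn ih =>
        rcases ih with ih | ih
        · by_cases hd : β' n = β n
          · left
            rw [branchNode_succ, branchNode_succ, ih, hd]
          · right
            rw [branchRun, branchNode_succ, ih]
            exact hsib n hn _ hd
        · exact Or.inr (hA.branchRun_mem_replicated (Nat.le_succ n) ih)
    constructor
    · intro n hn
      rcases hdich n hn with h' | h'
      · right
        rw [branchRun, h', hj₀]
        exact hle n hn
      · exact Or.inl h'
    · by_cases hR' : ∃ n, hA.branchRun t β' n ∈ A.replicated
      · obtain ⟨n, hn⟩ := hR'
        exact hgoal β' n _ hn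
      · push Not at hR'
        refine (hk.1.and_eventually (eventually_ge_atTop N)).mono ?_
        rintro n ⟨hn, hnN⟩
        right
        refine ⟨hR' n, ?_, hj₀ ▸ hev⟩
        rw [branchRun, (hdich n hnN).resolve_right (hR' n), hj₀]
        exact hn

end IsDeterministic

/-! ### The weak automaton -/

/-- The phases of the weak automaton: Eve may `wait` or declare that the tracked conditions hold
from now on; if she waits, Adam takes a step in phase `walk`. In phase `track`, Adam chooses a
branch and may start a `challenge`, in which a state of the tracked kind has to be reached. -/
inductive Phase
  | wait | walk | track | challenge | win
  deriving DecidableEq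

instance : Fintype Phase where
  elems := {.wait, .walk, .track, .challenge, .win}
  complete p := by cases p <;> decide

/-- The rank of a phase. -/
def Phase.rank : Phase → ℕ
  | wait => 1
  | walk => 1
  | track => 2
  | challenge => 3
  | win => 4

/-- The transitions of the weak automaton. A state consists of a phase, a code of a state of `A`
and a code of the guess that is used in phases `track` and `challenge`. -/
inductive WeakTrans {K : Type*} (A : AltAutomaton α Q) (e : K → Q) :
    Phase × K × K → α → Option Bool → Phase × K × K → Prop
  | decline (q m : K) (a : α) : WeakTrans A e (.wait, q, m) a none (.walk, q, m)
  | declare (q m m' : K) (a : α) : WeakTrans A e (.wait, q, m) a none (.track, q, m')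
  | walk {q q' : K} (m : K) {a : α} {d : Bool} : A.trans (e q) a (some d) (e q') →
      WeakTrans A e (.walk, q, m) a (some d) (.wait, q', m)
  | track {q q' m : K} {a : α} {d : Bool} : A.Safe (e q) (e m) →
      A.trans (e q) a (some d) (e q') → WeakTrans A e (.track, q, m) a (some d) (.track, q', m)
  | doubt {q m : K} (a : α) : A.Safe (e q) (e m) →
      WeakTrans A e (.track, q, m) a none (.challenge, q, m)
  | search {q q' m : K} {a : α} {d : Bool} : ¬ A.Goal (e q) (e m) →
      A.trans (e q) a (some d) (e q') →
      WeakTrans A e (.challenge, q, m) a (some d) (.challenge, q', m)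
  | success {q m : K} (a : α) : A.Goal (e q) (e m) →
      WeakTrans A e (.challenge, q, m) a none (.win, q, m)
  | stay (q m : K) (a : α) : WeakTrans A e (.win, q, m) a none (.win, q, m)

/-- The weak automaton that is equivalent to `A` if no `(0, 1)`-flower is replicated by an accepting
loop. In phase `track`, Eve gets stuck in states that are not safe. -/
def toWeak {K : Type*} (A : AltAutomaton α Q) (e : K → Q) (k₀ : K) :
    AltAutomaton α (Phase × K × K) where
  existential := {r | r.1 = .wait ∨ r.1 = .track ∧ ¬ A.Safe (e r.2.1) (e r.2.2)}
  init := (.wait, k₀, k₀)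
  trans := A.WeakTrans e
  rank r := r.1.rank

/-! ### Moves and plays of the weak automaton -/

section ToWeak

variable {K : Type*} {e : K → Q} {k₀ : K} {t : List Bool → α}

lemma mem_eve_toWeak {r : Phase × K × K} {v : List Bool} :
    (r, v) ∈ ((A.toWeak e k₀).game t).eve ↔
      r.1 = .wait ∨ r.1 = .track ∧ ¬ A.Safe (e r.2.1) (e r.2.2) := Iff.rfl

lemma move_toWeak {y z : (Phase × K × K) × List Bool} :
    ((A.toWeak e k₀).game t).move y z ↔
      ∃ d : Option Bool, A.WeakTrans e y.1 (t y.2) d z.1 ∧ z.2 = y.2 ++ d.toList := Iff.rfl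

lemma hasIndex_toWeak : (A.toWeak e k₀).HasIndex 1 4 := by
  refine ⟨⟨⟨(.wait, k₀, k₀), rfl⟩, ?_⟩, ⟨⟨(.win, k₀, k₀), rfl⟩, ?_⟩⟩
  · rintro _ ⟨⟨p, q⟩, rfl⟩
    cases p <;> simp [toWeak, Phase.rank]
  · rintro _ ⟨⟨p, q⟩, rfl⟩
    cases p <;> simp [toWeak, Phase.rank]

/-- The possible moves from a position in phase `challenge`. -/
lemma move_challenge {y z : (Phase × K × K) × List Bool}
    (h : ((A.toWeak e k₀).game t).move y z) (hy : y.1.1 = .challenge) :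
    (¬ A.Goal (e y.1.2.1) (e y.1.2.2) ∧ z.1.1 = .challenge ∧ z.2.length = y.2.length + 1 ∧
      z.1.2.2 = y.1.2.2) ∨ z.1.1 = .win := by
  obtain ⟨⟨p, q, m⟩, v⟩ := y
  obtain ⟨z, v'⟩ := z
  obtain ⟨d, hd, rfl : v' = _⟩ := move_toWeak.1 h
  dsimp only at hd hy
  subst hy
  cases hd <;> simp_all

/-- The possible moves from a position in phase `track`. -/
lemma move_track {y z : (Phase × K × K) × List Bool}
    (h : ((A.toWeak e k₀).game t).move y z) (hy : y.1.1 = .track) :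
    A.Safe (e y.1.2.1) (e y.1.2.2) ∧ ((z.1.1 = .track ∧ z.2.length = y.2.length + 1 ∧
      z.1.2.2 = y.1.2.2) ∨ z.1.1 = .challenge) := by
  obtain ⟨⟨p, q, m⟩, v⟩ := y
  obtain ⟨z, v'⟩ := z
  obtain ⟨d, hd, rfl : v' = _⟩ := move_toWeak.1 h
  dsimp only at hd hy
  subst hy
  cases hd <;> simp_all

lemma not_weakWin_of_odd {π : ℕ → (Phase × K × K) × List Bool} {i : ℕ}
    (hodd : ¬ Even (π i).1.1.rank) (hle : ∀ j, (π j).1.1.rank ≤ (π i).1.1.rank) :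
    ¬ ((A.toWeak e k₀).game t).WeakWin π := by
  rintro ⟨m, hm, hev⟩
  refine hodd ?_
  have : IsGreatest (Set.range fun j => ((A.toWeak e k₀).game t).rank (π j)) (π i).1.1.rank :=
    ⟨⟨i, rfl⟩, by rintro _ ⟨j, rfl⟩; exact hle j⟩
  rwa [this.unique hm]

lemma weakWin_of_even {π : ℕ → (Phase × K × K) × List Bool} {i : ℕ}
    (hev : Even (π i).1.1.rank) (hle : ∀ j, (π j).1.1.rank ≤ (π i).1.1.rank) :
    ((A.toWeak e k₀).game t).WeakWin π :=
  ⟨_, ⟨⟨i, rfl⟩, by rintro _ ⟨j, rfl⟩; exact hle j⟩, hev⟩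

/-- Without a challenge, tracking never ends: every move goes one level down and keeps the guess. -/
lemma track_or_challenge_of_move {π : ℕ → (Phase × K × K) × List Bool}
    (hm : ∀ n, ((A.toWeak e k₀).game t).move (π n) (π (n + 1)))
    (hc : ∀ n, (π n).1.1 ≠ .challenge) {i : ℕ} (hi : (π i).1.1 = .track) (n : ℕ) :
    (π (i + n)).1.1 = .track ∧ (π (i + n)).2.length = (π i).2.length + n ∧
      (π (i + n)).1.2.2 = (π i).1.2.2 := by
  induction n with
  | zero => exact ⟨hi, rfl, rfl⟩
  | succ n ih =>
    obtain ⟨h1, h2, h3⟩ := (move_track (hm (i + n)) ih.1).2.resolve_right (hc _)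
    exact ⟨h1, by rw [← Nat.add_assoc, h2, ih.2.1]; omega, h3.trans ih.2.2⟩

lemma challenge_of_move {π : ℕ → (Phase × K × K) × List Bool}
    (hm : ∀ n, ((A.toWeak e k₀).game t).move (π n) (π (n + 1)))
    (hw : ∀ n, (π n).1.1 ≠ .win) {i : ℕ} (hi : (π i).1.1 = .challenge) (n : ℕ) :
    (π (i + n)).1.1 = .challenge ∧ (π (i + n)).2.length = (π i).2.length + n ∧
      (π (i + n)).1.2.2 = (π i).1.2.2 := by
  induction n with
  | zero => exact ⟨hi, rfl, rfl⟩
  | succ n ih =>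
    obtain ⟨-, h1, h2, h3⟩ := (move_challenge (hm (i + n)) ih.1).resolve_right (hw _)
    exact ⟨h1, by rw [← Nat.add_assoc, h2, ih.2.1]; omega, h3.trans ih.2.2⟩

/-! ### Equivalence of the two automata -/

namespace IsDeterministic

/-- ε-transitions keep the simulated state and all others follow the transition function, so that
state stays the state of the run. -/
lemma run_of_weakTrans (hA : A.IsDeterministic) {r r' : Phase × K × K} {v : List Bool} {d : Option Bool}
    (h : A.WeakTrans e r (t v) d r') (hr : e r.2.1 = hA.run t v) :
    e r'.2.1 = hA.run t (v ++ d.toList) := by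
  cases h <;> dsimp only at hr <;> simp_all [hA.trans_run_iff]

variable [Finite Q]

lemma mem_weakLanguage_of_mem_language (hA : A.IsDeterministic) (he : Function.Surjective e) (hk : e k₀ = A.init)
    (ht : t ∈ A.language) : t ∈ (A.toWeak e k₀).weakLanguage := by
  classical
  rw [hA.mem_language_iff] at ht
  -- Eve declares as soon as the current node is good for some guess.
  let f : (Phase × K × K) × List Bool → (Phase × K × K) × List Bool := fun y =>
    if h : ∃ m, hA.Good t y.2 (e m) then ((.track, y.1.2.1, h.choose), y.2)
    else ((.walk, y.1.2.1, y.1.2.2), y.2)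
  refine RankedGame.EveWins.of_positional f
    (fun y => e y.1.2.1 = hA.run t y.2 ∧
      (y.1.1 = .track ∨ y.1.1 = .challenge → hA.Good t y.2 (e y.1.2.2)))
    ⟨hk, by rintro (h | h) <;> cases h⟩ ?_ ?_ ?_
  · rintro ⟨⟨p, q, m⟩, v⟩ ⟨hq, hgood⟩ hev
    rcases mem_eve_toWeak.1 hev with h | ⟨h, hs⟩
    · dsimp only at h
      subst h
      by_cases hg : ∃ m, hA.Good t v (e m)
      · simp only [f, hg, dite_true]
        exact ⟨none, .declare _ _ _ _, by simp⟩
      · simp only [f, hg, dite_false]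
        exact ⟨none, .decline _ _ _, by simp⟩
    · exact absurd (by rw [hq]; exact (hgood (Or.inl h)).safe) hs
  · rintro ⟨r, v⟩ ⟨r', v'⟩ ⟨hq, hgood⟩ ⟨d, hd, hv⟩ hf
    dsimp only at hd hv hq hgood
    subst hv
    refine ⟨hA.run_of_weakTrans hd hq, ?_⟩
    cases hd with
    | declare q m m' a =>
      intro _
      have := hf (Or.inl rfl)
      by_cases hg : ∃ m, hA.Good t v (e m)
      · simp only [f, hg, dite_true, Prod.mk.injEq, true_and] at this
        obtain rfl := this.1
        simpa using hg.choose_spec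
      · simp [f, hg] at this
    | track _ _ => exact fun _ => (hgood (by simp)).append _
    | search _ _ => exact fun _ => (hgood (by simp)).append _
    | doubt _ _ => intro _; simpa using hgood (by simp)
    | _ => simp
  · intro π hπ0 hI hm hf
    obtain ⟨β, hβ⟩ := exists_branch (fun n => (π n).2) fun n => by
      obtain ⟨d, -, hd⟩ := hm n
      exact ⟨_, hd.symm⟩
    by_cases hw : ∃ i, (π i).1.1 = .win
    · obtain ⟨i, hi⟩ := hw
      refine weakWin_of_even (i := i) (by rw [hi]; exact ⟨2, rfl⟩) fun j => ?_
      rw [hi]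
      cases (π j).1.1 <;> simp [Phase.rank]
    push Not at hw
    -- A challenge that never succeeds would descend along `β` forever, but below a good node `β`
    -- meets a goal, where `search` is unavailable.
    have hc : ∀ i, (π i).1.1 ≠ .challenge := by
      intro i hi
      obtain ⟨n, hn, hg⟩ := frequently_atTop.1
        (((hI i).2 (Or.inr hi)) β (hβ i).symm).2 (π i).2.length
      obtain ⟨k, rfl⟩ := Nat.exists_eq_add_of_le hn
      obtain ⟨h1, h2, h3⟩ := challenge_of_move hm hw hi k
      refine ((move_challenge (hm (i + k)) h1).resolve_right (hw _)).1 ?_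
      rwa [h3, (hI _).1, hβ (i + k), h2]
    by_cases htr : ∃ i, (π i).1.1 = .track
    · obtain ⟨i, hi⟩ := htr
      refine weakWin_of_even (i := i) (by rw [hi]; exact ⟨1, rfl⟩) fun j => ?_
      have h1 := hw j
      have h2 := hc j
      rw [hi]
      revert h1 h2; cases (π j).1.1 <;> simp [Phase.rank]
    push Not at htr
    exfalso
    have hwait : ∀ i, (π i).1.1 = .wait → (∀ m, ¬ hA.Good t (π i).2 (e m)) ∧
        π (i + 1) = ((.walk, (π i).1.2.1, (π i).1.2.2), (π i).2) := by
      intro i hi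
      have h1 := hf i (Or.inl hi)
      by_cases hg : ∃ m, hA.Good t (π i).2 (e m)
      · simp only [f, hg, dite_true] at h1
        exact absurd (by rw [h1]) (htr (i + 1))
      · simp only [f, hg, dite_false] at h1
        exact ⟨fun m hm => hg ⟨m, hm⟩, h1⟩
    -- Eternal waiting passes every depth of `β`, including that of the good node from
    -- `exists_good`.
    have hreach : ∀ n, ∃ i, (π i).1.1 = .wait ∧ (π i).2.length = n := by
      intro n
      induction n with
      | zero => exact ⟨0, by rw [hπ0]; rfl, by rw [hπ0]; rfl⟩
      | succ n ih =>
        obtain ⟨i, hi, hn⟩ := ih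
        obtain ⟨d, hd, hv⟩ := hm (i + 1)
        rw [(hwait i hi).2] at hd hv
        refine ⟨i + 1 + 1, ?_⟩
        rw [hv]
        generalize π (i + 1 + 1) = z at hd ⊢
        obtain ⟨z, _⟩ := z
        dsimp only at hd ⊢
        cases hd
        simp [hn]
    obtain ⟨n, m, hg⟩ := hA.exists_good ht β
    obtain ⟨m, rfl⟩ := he m
    obtain ⟨i, hi, hn⟩ := hreach n
    refine (hwait i hi).1 m ?_
    rwa [hβ i, hn]

lemma mem_language_of_mem_weakLanguage (hA : A.IsDeterministic) (he : Function.Surjective e) (hk : e k₀ = A.init)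
    (hfl : ¬ A.HasReplicatedFlower 0 1) (ht : t ∈ (A.toWeak e k₀).weakLanguage) :
    t ∈ A.language := by
  rw [hA.mem_language_iff]
  intro β
  let NoGoal : ℕ → K → Prop := fun n m => ∀ k ≥ n, ¬ A.Goal (hA.branchRun t β k) (e m)
  have hcons : ∀ v : List Bool, v = branchNode β v.length →
      v ++ [β v.length] = branchNode β (v ++ [β v.length]).length := by
    intro v hv
    rw [List.length_append, List.length_singleton, branchNode_succ, ← hv]
  -- Adam follows `β` and challenges exactly when no goal lies ahead, so no challenge of his can
  -- succeed.
  obtain ⟨π, hπ, hπ0, h⟩ := RankedGame.EveWins.exists_play ht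
    (fun y => e y.1.2.1 = hA.run t y.2 ∧ y.2 = branchNode β y.2.length ∧ y.1.1 ≠ .win ∧
      (y.1.1 = .challenge → NoGoal y.2.length y.1.2.2))
    (fun y z => y.1.1 = .track → z.1.1 = .track → ¬ NoGoal y.2.length y.1.2.2)
    ⟨hk, rfl, by simp [game, toWeak], by simp [game, toWeak]⟩ (by
      rintro ⟨⟨p, q, m⟩, v⟩ ⟨hq, hv, -, -⟩ hev ⟨r', v'⟩ ⟨d, hd, hv'⟩
      dsimp only at hd hv' hq hv
      subst hv'
      have hrun := hA.run_of_weakTrans hd hq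
      rcases mem_eve_toWeak.1 hev with h | ⟨h, hs⟩
      · dsimp only at h
        subst h
        cases hd <;> simpa using ⟨by simpa using hrun, hv⟩
      · dsimp only at h hs
        subst h
        cases hd <;> contradiction) (by
      rintro ⟨⟨p, q, m⟩, v⟩ ⟨hq, hv, hw, hc⟩ hev
      dsimp only at hq hv hw hc
      obtain ⟨q', hq'⟩ := he (hA.run t (v ++ [β v.length]))
      have htr : A.trans (e q) (t v) (some (β v.length)) (e q') := by
        rw [hq, hq', hA.trans_run_iff]
      have hs : p = .track → A.Safe (e q) (e m) := fun hp => by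
        by_contra hs
        exact hev (Or.inr ⟨hp, hs⟩)
      match p with
      | .wait => exact absurd (Or.inl rfl) hev
      | .walk => exact ⟨((.wait, q', m), v ++ [β v.length]), ⟨some _, .walk _ htr, rfl⟩,
          ⟨hq', hcons v hv, by simp, by simp⟩, by simp⟩
      | .track =>
        by_cases hg : NoGoal v.length m
        · exact ⟨((.challenge, q, m), v), ⟨none, .doubt _ (hs rfl), by simp⟩,
            ⟨hq, hv, by simp, fun _ => hg⟩, by simp⟩
        · exact ⟨((.track, q', m), v ++ [β v.length]), ⟨some _, .track (hs rfl) htr, rfl⟩,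
            ⟨hq', hcons v hv, by simp, by simp⟩, fun _ _ => hg⟩
      | .challenge =>
        have hg := hc rfl
        refine ⟨((.challenge, q', m), v ++ [β v.length]), ⟨some _, .search ?_ htr, rfl⟩,
            ⟨hq', hcons v hv, by simp, fun _ k hk => hg k ?_⟩, by simp⟩
        · have := hg _ le_rfl
          rwa [branchRun, ← hv, ← hq] at this
        · simp at hk
          omega
      | .win => exact absurd rfl hw)
  have hm := fun n => (h n).2.1
  have hw := fun n => (h n).1.2.2.1
  -- Phase `win` is excluded, so a challenge would make 3 the highest rank and Eve would lose.
  have hc : ∀ i, (π i).1.1 ≠ .challenge := by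
    intro i hi
    refine not_weakWin_of_odd (i := i) (by rw [hi]; decide) (fun j => ?_) hπ
    have h1 := hw j
    rw [hi]
    revert h1; cases (π j).1.1 <;> simp [Phase.rank]
  by_cases htr : ∃ i, (π i).1.1 = .track
  · obtain ⟨i, hi⟩ := htr
    have hstep := track_or_challenge_of_move hm hc hi
    refine hA.parityAccepts_of_goal hfl (N := (π i).2.length) (m := e (π i).1.2.2) ?_ ?_
    · intro n hn
      obtain ⟨k, rfl⟩ := Nat.exists_eq_add_of_le hn
      obtain ⟨h1, h2, h3⟩ := hstep k
      have := (move_track (hm (i + k)) h1).1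
      rwa [h3, (h (i + k)).1.1, (h (i + k)).1.2.1, h2] at this
    · rw [frequently_atTop]
      intro n
      -- Adam's not challenging at this position means that a goal still lies ahead.
      obtain ⟨h1, h2, h3⟩ := hstep n
      have := (h (i + n)).2.2 h1 (hstep (n + 1)).1
      simp only [NoGoal, h2, h3] at this
      push Not at this
      obtain ⟨k, hk, hg⟩ := this
      exact ⟨k, by omega, hg⟩
  · push Not at htr
    refine absurd hπ (not_weakWin_of_odd (i := 0) ?_ fun j => ?_)
    · rw [hπ0]
      simp [game, toWeak, Phase.rank]
    · have h1 := hw j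
      have h2 := hc j
      have h3 := htr j
      rw [hπ0]
      revert h1 h2 h3; cases (π j).1.1 <;> simp [Phase.rank, game, toWeak]

end IsDeterministic

end ToWeak

end AltAutomaton

theorem mainTheorem4 :
    ∃ C : ℕ, ∀ (α : Type*) [Finite α] (Q : Type*) [Finite Q] (A : AltAutomaton α Q),
      A.IsDeterministic → ¬ A.HasReplicatedFlower 0 1 →
        ∃ (R : Type) (_ : Finite R) (B : AltAutomaton α R),
          B.HasIndex 1 4 ∧ Nat.card R ≤ C * Nat.card Q ^ 2 ∧ B.weakLanguage = A.language := by
  -- There are five phases; the factor `n ^ 2` counts the current state and the guessed rank,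
  -- represented by a state.
  refine ⟨5, fun α _ Q _ A hA hfl => ?_⟩
  -- `Q` may live in any universe but `R` must be in `Type`, hence the coding of states by `Fin`.
  let e := (Finite.equivFin Q).symm
  refine ⟨AltAutomaton.Phase × Fin (Nat.card Q) × Fin (Nat.card Q), inferInstance,
    A.toWeak e (e.symm A.init), AltAutomaton.hasIndex_toWeak, ?_, ?_⟩
  · have : Fintype.card AltAutomaton.Phase = 5 := rfl
    simp [this, sq]
  · exact Set.Subset.antisymm
      (fun t ht => hA.mem_language_of_mem_weakLanguage e.surjective (by simp) hfl ht)
      (fun t ht => hA.mem_weakLanguage_of_mem_language e.surjective (by simp) ht)
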